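/- **Setting.** Let $p$ be a real-analytic function on $(0,\infty)$ such that $p'(\xi)>0$ and $3p'(\xi)+\xi p''(\xi)>0$ for all $\xi>0$, $\lim_{\xi\to0^+}\xi^3p'(\xi)=0$ and $\lim_{\xi\to\infty}W(\xi)=\infty$, where $$W(\xi)=\frac{\xi^4p'(\xi)-2\xi(p(\xi)-p(1))-2\xi\log\xi}{\max_{\eta\in[1,\xi]}p'(\eta)+1},\qquad \xi\ge1.$$ For a period $L>0$ let $X$ be the space of continuous, even, $L$-periodic functions $\mathbb R\to\mathbb R$ with the sup norm. For positive $f\in X$ let $\mathcal H^{-1}(f)$ be the unique $L$-periodic $C^2$ function $\phi$ with $-\phi''+e^{\phi}=f$, and for $c\in\mathbb R$ set $$\mathcal F(c,f)=\tfrac{c^2}{2}\Big(\tfrac1{f^2}-1\Big)+p(f)-p(1)+\mathcal H^{-1}(f).$$ A local branch for the period $L$ is a pair of analytic maps $(\Psi,\Phi):(-\varepsilon,\varepsilon)\to\mathbb R\times X$, for some $\varepsilon>0$, such that $\Phi(s)>0$ and $\mathcal F(\Psi(s),\Phi(s))=0$ for all $|s|<\varepsilon$, $$\Psi(0)=\sqrt{p'(1)+\tfrac1{1+(2\pi/L)^2}},\qquad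 \Phi(0)=1,$$ and $\Phi(s)=1+s\cos\!\big(\tfrac{2\pi}{L}\,\cdot\big)+O(s^2)$ in $X$ as $s\to0$. **Proposition 4.3.** Fix $p$ as above. 1. For every $L>0$ and every local branch for the period $L$, $\Psi'(0)=0$. 2. Put $p_1=p'(1)$, $p_2=p''(1)$, $p_3=p'''(1)$, $q=3p_1+p_2$, and $$\begin{aligned}Q(t)={}&6\big(q(1+t)^2+3t+2\big)^2(1+t)(1+4t)-\big(q(1+t)^2(1+4t)+12t^2+15t+2\big)^2(1+t)\\&+3t(1+t)^3(1+4t)\big((12p_1-p_3)(1+t)+12\big)-6t(1+2t).\end{aligned}$$ Then $Q$ is not the zero polynomial, $\deg Q\le 8$, and for every $L>0$ and every local branch for the period $L$, $\Psi''(0)=0$ if and only if $Q\big((2\pi/L)^2\big)=0$. 3. Consequently there is a set $\mathcal N\subset(0,\infty)$ with at most $8$ elements, depending only on $p$, namely the set of $L>0$ with $Q\big((2\pi/L)^2\big)=0$, such that $\Psi''(0)\neq0$ for every $L\in(0,\infty)\setminus\mathcal N$ and every local branch for the period $L$. -/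

import Mathlib

open scoped BoundedContinuousFunction Topology

noncomputable section

namespace EulerPoisson

/-- The function `W` entering the growth condition on the pressure profile:
`W ξ = (ξ⁴ p'(ξ) - 2 ξ (p(ξ) - p(1)) - 2 ξ log ξ) / (max_{[1, ξ]} p' + 1)`, used for `ξ ≥ 1`. -/
def growthW (p : ℝ → ℝ) (ξ : ℝ) : ℝ :=
  (ξ ^ 4 * deriv p ξ - 2 * ξ * (p ξ - p 1) - 2 * ξ * Real.log ξ) /
    (sSup (deriv p '' Set.Icc 1 ξ) + 1)

/-- The standing assumptions on the pressure profile `p` on `(0, ∞)`. -/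
structure AdmissiblePressure (p : ℝ → ℝ) : Prop where
  analytic : AnalyticOnNhd ℝ p (Set.Ioi 0)
  deriv_pos : ∀ ξ : ℝ, 0 < ξ → 0 < deriv p ξ
  convexity : ∀ ξ : ℝ, 0 < ξ → 0 < 3 * deriv p ξ + ξ * iteratedDeriv 2 p ξ
  limit_zero : Filter.Tendsto (fun ξ : ℝ => ξ ^ 3 * deriv p ξ) (𝓝[>] 0) (𝓝 0)
  limit_infty : Filter.Tendsto (growthW p) Filter.atTop Filter.atTop

/-- The nonlinear elliptic operator `𝓗(φ) = -φ'' + exp φ`. -/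
def ellipticH (φ : ℝ → ℝ) (x : ℝ) : ℝ :=
  -deriv (deriv φ) x + Real.exp (φ x)

/-- `φ` is an `L`-periodic `C²` solution of `𝓗(φ) = f`. -/
def IsEllipticSolution (L : ℝ) (f φ : ℝ → ℝ) : Prop :=
  ContDiff ℝ 2 φ ∧ Function.Periodic φ L ∧ ∀ x, ellipticH φ x = f x

open Classical in
/-- The inverse operator `𝓗⁻¹`. For a positive continuous `L`-periodic `f`, `𝓗⁻¹(f)` is the
(unique) `L`-periodic `C²` function `φ` with `-φ'' + exp φ = f`; the operator is only used on
such `f`. -/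
def ellipticHInv (L : ℝ) (f : ℝ → ℝ) : ℝ → ℝ :=
  if h : ∃ φ : ℝ → ℝ, IsEllipticSolution L f φ then h.choose else 0

/-- The local part `𝓖_c(ξ) = (c² / 2) (1 / ξ² - 1) + p(ξ) - p(1)`. -/
def localG (p : ℝ → ℝ) (c ξ : ℝ) : ℝ :=
  c ^ 2 / 2 * (1 / ξ ^ 2 - 1) + p ξ - p 1

/-- The travelling-wave functional `𝓕(c, f) = 𝓖_c(f) + 𝓗⁻¹(f)`. -/
def waveF (L : ℝ) (p : ℝ → ℝ) (c : ℝ) (f : ℝ → ℝ) (x : ℝ) : ℝ :=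
  localG p c (f x) + ellipticHInv L f x

/-- The space `X = C_even(ℝ / Lℤ)` with the sup norm, realised as the space of bounded continuous
functions on `ℝ` that are even and `L`-periodic. -/
def evenPeriodic (L : ℝ) : Submodule ℝ (ℝ →ᵇ ℝ) where
  carrier := {f | (∀ x, f (-x) = f x) ∧ Function.Periodic f L}
  zero_mem' := ⟨fun _ => rfl, fun _ => rfl⟩
  add_mem' := by
    rintro f g ⟨hf, hf'⟩ ⟨hg, hg'⟩
    exact ⟨fun x => by simp [hf x, hg x], fun x => by simp [hf' x, hg' x]⟩
  smul_mem' := by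
    rintro a f ⟨hf, hf'⟩
    exact ⟨fun x => by simp [hf x], fun x => by simp [hf' x]⟩

/-- The constant function `1` as an element of `X`. -/
def oneX (L : ℝ) : evenPeriodic L :=
  ⟨BoundedContinuousFunction.const ℝ 1, fun _ => rfl, fun _ => rfl⟩

/-- The function `x ↦ cos (2π x / L)` as an element of `X`. -/
def cosX (L : ℝ) : evenPeriodic L :=
  ⟨BoundedContinuousFunction.ofNormedAddCommGroup
      (fun x : ℝ => Real.cos (2 * Real.pi / L * x)) (by fun_prop) 1
      (fun x => by simpa using Real.abs_cos_le_one _),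
    fun x => by simp,
    fun x => by
      rcases eq_or_ne L 0 with rfl | hL
      · simp
      · have h : 2 * Real.pi / L * (x + L) = 2 * Real.pi / L * x + 2 * Real.pi := by
          field_simp
        simp [h]⟩

/-- The bifurcation speed `c₀ = √(p'(1) + 1 / (1 + (2π / L)²))`. -/
def bifurcationSpeed (p : ℝ → ℝ) (L : ℝ) : ℝ :=
  Real.sqrt (deriv p 1 + 1 / (1 + (2 * Real.pi / L) ^ 2))

/-- `(Ψ, Φ) : (-ε, ε) → ℝ × X` is a local bifurcation branch of `𝓕 = 0` at `(c₀, 1)` in the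
direction `cos (2π x / L)`: an analytic curve of solutions with positive profiles, starting from
`(c₀, 1)`, with `Φ(s) = 1 + s cos (2π x / L) + O(s²)` in `X`. -/
structure IsLocalBranch (p : ℝ → ℝ) (L ε : ℝ) (Ψ : ℝ → ℝ) (Φ : ℝ → evenPeriodic L) : Prop where
  eps_pos : 0 < ε
  analytic_speed : AnalyticOnNhd ℝ Ψ (Set.Ioo (-ε) ε)
  analytic_profile : AnalyticOnNhd ℝ Φ (Set.Ioo (-ε) ε)
  speed_zero : Ψ 0 = bifurcationSpeed p L
  profile_zero : Φ 0 = oneX L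
  profile_pos : ∀ s ∈ Set.Ioo (-ε) ε, ∀ x : ℝ, 0 < (Φ s : ℝ →ᵇ ℝ) x
  solves : ∀ s ∈ Set.Ioo (-ε) ε, ∀ x : ℝ, waveF L p (Ψ s) (Φ s : ℝ →ᵇ ℝ) x = 0
  expansion : (fun s : ℝ => Φ s - oneX L - s • cosX L) =O[𝓝 0] fun s : ℝ => s ^ 2

open Polynomial in
/-- The explicit polynomial in `t = (2π / L)²`, with `p₁ = p'(1)`, `p₂ = p''(1)`, `p₃ = p'''(1)`:
with `q = 3 p₁ + p₂`,
`6 (q (1+t)² + 3t + 2)² (1+t) (1+4t) - (q (1+t)² (1+4t) + 12t² + 15t + 2)² (1+t)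
  + 3t (1+t)³ (1+4t) ((12 p₁ - p₃) (1+t) + 12) - 6t (1+2t)`. -/
def periodPoly (p₁ p₂ p₃ : ℝ) : ℝ[X] :=
  6 * (C (3 * p₁ + p₂) * (1 + X) ^ 2 + 3 * X + 2) ^ 2 * (1 + X) * (1 + 4 * X)
    - (C (3 * p₁ + p₂) * (1 + X) ^ 2 * (1 + 4 * X) + 12 * X ^ 2 + 15 * X + 2) ^ 2 * (1 + X)
    + 3 * X * (1 + X) ^ 3 * (1 + 4 * X) * (C (12 * p₁ - p₃) * (1 + X) + 12)
    - 6 * X * (1 + 2 * X)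

/-- The polynomial attached to a pressure profile `p`, through `p'(1)`, `p''(1)`, `p'''(1)`. -/
def pressurePoly (p : ℝ → ℝ) : Polynomial ℝ :=
  periodPoly (deriv p 1) (iteratedDeriv 2 p 1) (iteratedDeriv 3 p 1)

end EulerPoisson

end

noncomputable section

namespace EulerPoisson

open Filter Asymptotics

/-! Put `t = (2π/L)²`, `K = cos(2πx/L)`, `D = Ψ(0)² - p'(1) = 1/(1+t)`. Along a branch `φ = -𝓖(Ψ,
Φ)` solves `-φ'' + exp φ = Φ` for small `s ≠ 0` (`eventually_isEllipticSolution`). Green's identity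
turns this into `∫ (μφ + exp φ - Φ) w = 0` over a period for each periodic eigenfunction `w` of
`-d²/dx²` with eigenvalue `μ`. This weak form needs only expansions uniform in `x`, so neither
smoothness of `𝓗⁻¹` nor differentiability in `x` of the coefficients enters.

Write `Φ = 1 + sK + s²a + s³b + O(s⁴)`. Projection on `K` meets the unknown coefficients through the
factor `(1+t)D - 1 = 0`: at order two `a` drops out, which forces `ΨΨ' = 0` at `s = 0`; at order
three `b` drops out, which leaves `ΨΨ''` and `∫ aK²`. The latter is known from `∫ a` and `∫ a
cos(4πx/L)`, given by the order two projections on `1` and `cos(4πx/L)`, which are solvable because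
`D - 1` and `(1+4t)D - 1` are nonzero. Elimination (`eval_periodPoly_of_projections`) gives `Q(t)`
as a nonzero multiple of `ΨΨ''`. Finally `Q(-1) = -6`, so `Q` has at most eight roots, and `L ↦
(2π/L)²` is injective on positive periods. -/

theorem eq_zero_of_pow_smul_isBigO {E : Type*} [NormedAddCommGroup E] [NormedSpace ℝ E] {v : E}
    {n : ℕ} (h : (fun s : ℝ => s ^ n • v) =O[𝓝[≠] 0] fun s => s ^ (n + 1)) : v = 0 := by
  have h1 : (fun _ : ℝ => v) =O[𝓝[≠] 0] fun s : ℝ => s := by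
    have h2 := (isBigO_refl (fun s : ℝ => (s ^ n)⁻¹) (𝓝[≠] 0)).smul h
    refine h2.congr' ?_ ?_ <;> filter_upwards [self_mem_nhdsWithin] with s hs
    · have : s ^ n ≠ 0 := pow_ne_zero _ hs
      simp [smul_smul, this]
    · have : s ^ n ≠ 0 := pow_ne_zero _ hs
      simp only [smul_eq_mul, pow_succ]
      field_simp
  have h3 : Tendsto (fun s : ℝ => s) (𝓝[≠] 0) (𝓝 0) := tendsto_nhdsWithin_of_tendsto_nhds tendsto_id
  exact tendsto_nhds_unique tendsto_const_nhds (h1.trans_tendsto h3)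

theorem isBigO_pow_smul {E : Type*} [NormedAddCommGroup E] [NormedSpace ℝ E] (n : ℕ) (v : E) :
    (fun s : ℝ => s ^ n • v) =O[𝓝 0] fun s => s ^ n :=
  IsBigO.of_bound ‖v‖ (Eventually.of_forall fun s => by rw [norm_smul, mul_comm])

theorem isBigO_pow_pow_of_le {m n : ℕ} (h : m ≤ n) :
    (fun s : ℝ => s ^ n) =O[𝓝 0] fun s => s ^ m := by
  have h1 : (fun s : ℝ => s ^ (n - m)) =O[𝓝 0] fun _ => (1 : ℝ) :=
    (continuous_pow (n - m)).continuousAt.isBigO_one ℝ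
  refine ((isBigO_refl (fun s : ℝ => s ^ m) (𝓝 0)).mul h1).congr (fun s => ?_)
    fun s => mul_one _
  rw [← pow_add, Nat.add_sub_cancel' h]

theorem isBigO_pow_pow_punctured {m n : ℕ} (h : m ≤ n) :
    (fun s : ℝ => s ^ n) =O[𝓝[≠] 0] fun s => s ^ m :=
  (isBigO_pow_pow_of_le h).mono nhdsWithin_le_nhds

/-- A cubic polynomial which is `O(s⁴)` at `0` vanishes. -/
theorem cubic_eq_zero_of_isBigO {a b c d : ℝ}
    (h : (fun s : ℝ => a + s * b + s ^ 2 * c + s ^ 3 * d) =O[𝓝[≠] 0] fun s => s ^ 4) :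
    a = 0 ∧ b = 0 ∧ c = 0 ∧ d = 0 := by
  have key (n : ℕ) (v : ℝ) : (fun s : ℝ => s ^ n * v) =O[𝓝[≠] 0] fun s => s ^ n := by
    simpa [mul_comm] using (isBigO_refl (fun s : ℝ => s ^ n) (𝓝[≠] 0)).const_mul_left v
  -- The coefficients are removed from the lowest order up: the remaining terms are absorbed in the
  -- next power of `s`.
  have ha : a = 0 := by
    refine eq_zero_of_pow_smul_isBigO (n := 0) ?_
    have := ((h.trans (isBigO_pow_pow_punctured (show 1 ≤ 4 by norm_num))).sub
      (key 1 b)).sub (((key 2 c).trans (isBigO_pow_pow_punctured (show 1 ≤ 2 by norm_num))).add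
      ((key 3 d).trans (isBigO_pow_pow_punctured (show 1 ≤ 3 by norm_num))))
    refine this.congr_left fun s => ?_
    simp only [smul_eq_mul]; ring
  subst ha
  have hb : b = 0 := by
    refine eq_zero_of_pow_smul_isBigO (n := 1) ?_
    have := ((h.trans (isBigO_pow_pow_punctured (show 2 ≤ 4 by norm_num))).sub
      (key 2 c)).sub ((key 3 d).trans (isBigO_pow_pow_punctured (show 2 ≤ 3 by norm_num)))
    refine this.congr_left fun s => ?_
    simp only [smul_eq_mul]; ring
  subst hb
  have hc : c = 0 := by
    refine eq_zero_of_pow_smul_isBigO (n := 2) ?_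
    have := (h.trans (isBigO_pow_pow_punctured (show 3 ≤ 4 by norm_num))).sub (key 3 d)
    refine this.congr_left fun s => ?_
    simp only [smul_eq_mul]; ring
  subst hc
  refine ⟨rfl, rfl, rfl, eq_zero_of_pow_smul_isBigO (n := 3) ?_⟩
  refine h.congr_left fun s => ?_
  simp only [smul_eq_mul]; ring

/-! ### Calculus of cubic expansions uniform in the space variable -/

/-- The family `f s` of real functions admits the expansion
`a + s b + s² c + s³ d + O(s⁴)` as `s → 0`, uniformly on `ℝ`. -/
def HasExpansion (f : ℝ → ℝ → ℝ) (a b c d : ℝ →ᵇ ℝ) : Prop :=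
  (fun z : ℝ × ℝ => f z.1 z.2 - (a z.2 + z.1 * b z.2 + z.1 ^ 2 * c z.2 + z.1 ^ 3 * d z.2))
    =O[𝓝 0 ×ˢ ⊤] fun z => z.1 ^ 4

/-- The real function `h` has the third order Taylor expansion
`h y = h₀ + h₁ y + h₂ y² + h₃ y³ + O(y⁴)` at `0`. -/
def HasCubicTaylor (h : ℝ → ℝ) (h₀ h₁ h₂ h₃ : ℝ) : Prop :=
  (fun y : ℝ => h y - (h₀ + y * h₁ + y ^ 2 * h₂ + y ^ 3 * h₃)) =O[𝓝 0] fun y => y ^ 4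

theorem isBigO_one_snd (a : ℝ →ᵇ ℝ) :
    (fun z : ℝ × ℝ => a z.2) =O[𝓝 0 ×ˢ ⊤] fun _ => (1 : ℝ) :=
  IsBigO.of_bound ‖a‖ (Eventually.of_forall fun z => by simpa using a.norm_coe_le_norm z.2)

theorem tendsto_fst_nhds_zero :
    Tendsto (fun z : ℝ × ℝ => z.1) (𝓝 0 ×ˢ (⊤ : Filter ℝ)) (𝓝 0) := tendsto_fst

theorem isBigO_one_fst :
    (fun z : ℝ × ℝ => z.1) =O[𝓝 0 ×ˢ (⊤ : Filter ℝ)] fun _ => (1 : ℝ) :=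
  tendsto_fst_nhds_zero.isBigO_one ℝ

theorem isBigO_one_cubic (a b c d : ℝ →ᵇ ℝ) :
    (fun z : ℝ × ℝ => a z.2 + z.1 * b z.2 + z.1 ^ 2 * c z.2 + z.1 ^ 3 * d z.2)
      =O[𝓝 0 ×ˢ ⊤] fun _ => (1 : ℝ) := by
  have h1 := isBigO_one_fst.mul (isBigO_one_snd b)
  have h2 := (isBigO_one_fst.pow 2).mul (isBigO_one_snd c)
  have h3 := (isBigO_one_fst.pow 3).mul (isBigO_one_snd d)
  simp only [one_pow, mul_one] at h1 h2 h3
  exact (((isBigO_one_snd a).add h1).add h2).add h3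

theorem isBigO_pow_fst {m n : ℕ} (h : m ≤ n) :
    (fun z : ℝ × ℝ => z.1 ^ n) =O[𝓝 0 ×ˢ (⊤ : Filter ℝ)] fun z => z.1 ^ m :=
  (isBigO_pow_pow_of_le h).comp_tendsto tendsto_fst_nhds_zero

namespace HasExpansion

variable {f g : ℝ → ℝ → ℝ} {a b c d a' b' c' d' : ℝ →ᵇ ℝ}

theorem congr_coeff (h : HasExpansion f a b c d) (ha : a = a') (hb : b = b') (hc : c = c')
    (hd : d = d') : HasExpansion f a' b' c' d' := by
  subst ha hb hc hd; exact h

theorem isBigO_one (h : HasExpansion f a b c d) :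
    (fun z : ℝ × ℝ => f z.1 z.2) =O[𝓝 0 ×ˢ ⊤] fun _ => (1 : ℝ) := by
  have h1 := (h.trans (isBigO_pow_fst (Nat.zero_le 4))).congr_right (fun _ => pow_zero _)
  refine (h1.add (isBigO_one_cubic a b c d)).congr_left fun z => by ring

theorem isBigO_fst (h : HasExpansion f 0 b c d) :
    (fun z : ℝ × ℝ => f z.1 z.2) =O[𝓝 0 ×ˢ ⊤] fun z => z.1 := by
  have h1 := (h.trans (isBigO_pow_fst (show 1 ≤ 4 by norm_num))).congr_right (fun _ => pow_one _)
  have h2 := (isBigO_refl (fun z : ℝ × ℝ => z.1) (𝓝 0 ×ˢ ⊤)).mul (isBigO_one_cubic b c d 0)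
  simp only [mul_one] at h2
  refine (h1.add h2).congr_left fun z => ?_
  simp only [BoundedContinuousFunction.coe_zero, Pi.zero_apply]
  ring

theorem add (hf : HasExpansion f a b c d) (hg : HasExpansion g a' b' c' d') :
    HasExpansion (fun s x => f s x + g s x) (a + a') (b + b') (c + c') (d + d') := by
  refine (IsBigO.add hf hg).congr_left fun z => ?_
  simp only [BoundedContinuousFunction.coe_add, Pi.add_apply]
  ring

theorem const_mul (r : ℝ) (hf : HasExpansion f a b c d) :
    HasExpansion (fun s x => r * f s x) (r • a) (r • b) (r • c) (r • d) := by
  refine (IsBigO.const_mul_left hf r).congr_left fun z => ?_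
  simp only [BoundedContinuousFunction.coe_smul, smul_eq_mul]
  ring

theorem const (r : ℝ) : HasExpansion (fun _ _ => r) (r • 1) 0 0 0 := by
  refine (isBigO_zero _ _).congr_left fun z => ?_
  simp

theorem of_cubicTaylor {h : ℝ → ℝ} {h₀ h₁ h₂ h₃ : ℝ} (hh : HasCubicTaylor h h₀ h₁ h₂ h₃) :
    HasExpansion (fun s _ => h s) (h₀ • 1) (h₁ • 1) (h₂ • 1) (h₃ • 1) := by
  refine (hh.comp_tendsto tendsto_fst_nhds_zero).congr_left fun z => ?_
  simp

theorem mul (hf : HasExpansion f a b c d) (hg : HasExpansion g a' b' c' d') :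
    HasExpansion (fun s x => f s x * g s x) (a * a') (a * b' + b * a')
      (a * c' + b * b' + c * a') (a * d' + b * c' + c * b' + d * a') := by
  have h1 := IsBigO.mul hf hg.isBigO_one
  have h2 := (isBigO_one_cubic a b c d).mul hg
  -- The terms of degree 4 to 6 in the product of the two cubics, written as `s⁴` times a bounded
  -- function.
  have h3 := (isBigO_refl (fun z : ℝ × ℝ => z.1 ^ 4) (𝓝 0 ×ˢ ⊤)).mul
    (isBigO_one_cubic (b * d' + c * c' + d * b') (c * d' + d * c') (d * d') 0)
  simp only [mul_one, one_mul] at h1 h2 h3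
  refine ((h1.add h2).add h3).congr_left fun z => ?_
  simp only [BoundedContinuousFunction.coe_add, BoundedContinuousFunction.coe_mul, Pi.add_apply,
    Pi.mul_apply, BoundedContinuousFunction.coe_zero, Pi.zero_apply]
  ring

/-- The vanishing constant term makes `f = O(s)` uniformly in `x`, so the Taylor remainder `O(f⁴)`
is `O(s⁴)`. -/
theorem comp_cubicTaylor {h : ℝ → ℝ} {h₀ h₁ h₂ h₃ : ℝ} (hh : HasCubicTaylor h h₀ h₁ h₂ h₃)
    (hf : HasExpansion f 0 b c d) :
    HasExpansion (fun s x => h (f s x)) (h₀ • 1) (h₁ • b) (h₁ • c + h₂ • b ^ 2)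
      (h₁ • d + (2 * h₂) • (b * c) + h₃ • b ^ 3) := by
  have ht : Tendsto (fun z : ℝ × ℝ => f z.1 z.2) (𝓝 0 ×ˢ ⊤) (𝓝 0) :=
    hf.isBigO_fst.trans_tendsto tendsto_fst_nhds_zero
  have h1 := (hh.comp_tendsto ht).trans (hf.isBigO_fst.pow 4)
  have h2 := (((const h₀).add (hf.const_mul h₁)).add ((hf.mul hf).const_mul h₂)).add
    ((hf.mul (hf.mul hf)).const_mul h₃)
  refine (IsBigO.add h1 h2).congr_left fun z => ?_
  simp
  ring

/-- The coefficients of an expansion of a family which is orthogonal to `g` are orthogonal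
to `g`. -/
theorem integral_eq_zero {L : ℝ} {w : ℝ →ᵇ ℝ} (hL : 0 < L) (hf : HasExpansion f a b c d)
    (hcont : ∀ᶠ s in 𝓝[≠] 0, Continuous (f s))
    (hint : ∀ᶠ s in 𝓝[≠] 0, ∫ x in 0..L, f s x * w x = 0) :
    (∫ x in 0..L, (b * w) x) = 0 ∧ (∫ x in 0..L, (c * w) x) = 0 ∧
      (∫ x in 0..L, (d * w) x) = 0 := by
  obtain ⟨K, hK⟩ := IsBigO.bound hf
  obtain ⟨U, hU, V, hV, hUV⟩ := mem_prod_iff.1 hK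
  rw [mem_top] at hV
  subst hV
  have hi (u : ℝ →ᵇ ℝ) : IntervalIntegrable (fun x => (u * w) x) MeasureTheory.volume 0 L :=
    (u * w).continuous.intervalIntegrable _ _
  -- Integration over the period turns the uniform remainder bound `K s⁴` into `K‖w‖L s⁴`, so the
  -- integrated coefficients form a real cubic of size `O(s⁴)`.
  have key : (fun s : ℝ => (∫ x in 0..L, (a * w) x) + s * (∫ x in 0..L, (b * w) x)
      + s ^ 2 * (∫ x in 0..L, (c * w) x) + s ^ 3 * (∫ x in 0..L, (d * w) x))
      =O[𝓝[≠] 0] fun s => s ^ 4 := by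
    refine IsBigO.of_bound (K * ‖w‖ * L) ?_
    filter_upwards [hcont, hint, nhdsWithin_le_nhds hU] with s hs hs' hsU
    have hrem : ((∫ x in 0..L, (a * w) x) + s * (∫ x in 0..L, (b * w) x)
        + s ^ 2 * (∫ x in 0..L, (c * w) x) + s ^ 3 * (∫ x in 0..L, (d * w) x)) =
        - ∫ x in 0..L, (f s x - (a x + s * b x + s ^ 2 * c x + s ^ 3 * d x)) * w x := by
      have h1 : (fun x => (f s x - (a x + s * b x + s ^ 2 * c x + s ^ 3 * d x)) * w x) =
          fun x => f s x * w x - ((a * w) x + s * (b * w) x + s ^ 2 * (c * w) x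
            + s ^ 3 * (d * w) x) := by
        funext x
        simp only [BoundedContinuousFunction.coe_mul, Pi.mul_apply]
        ring
      have i1 : IntervalIntegrable (fun x => f s x * w x) MeasureTheory.volume 0 L :=
        (hs.mul w.continuous).intervalIntegrable _ _
      have i2 (r : ℝ) (u : ℝ →ᵇ ℝ) :
          IntervalIntegrable (fun x => r * (u * w) x) MeasureTheory.volume 0 L :=
        (hi u).const_mul r
      have i3 : IntervalIntegrable (fun x => (a * w) x + s * (b * w) x)
          MeasureTheory.volume 0 L := (hi a).add (i2 s b)
      have i4 : IntervalIntegrable (fun x => (a * w) x + s * (b * w) x + s ^ 2 * (c * w) x)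
          MeasureTheory.volume 0 L := i3.add (i2 _ c)
      have i5 : IntervalIntegrable (fun x => (a * w) x + s * (b * w) x + s ^ 2 * (c * w) x
          + s ^ 3 * (d * w) x) MeasureTheory.volume 0 L := i4.add (i2 _ d)
      rw [h1, intervalIntegral.integral_sub i1 i5, intervalIntegral.integral_add i4 (i2 _ d),
        intervalIntegral.integral_add i3 (i2 _ c), intervalIntegral.integral_add (hi a) (i2 s b),
        hs']
      simp only [intervalIntegral.integral_const_mul]
      ring
    rw [hrem, norm_neg]
    have hb : ∀ x ∈ Set.uIoc 0 L,
        ‖(f s x - (a x + s * b x + s ^ 2 * c x + s ^ 3 * d x)) * w x‖ ≤ K * ‖s ^ 4‖ * ‖w‖ := by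
      intro x _
      have h2 : ‖f s x - (a x + s * b x + s ^ 2 * c x + s ^ 3 * d x)‖ ≤ K * ‖s ^ 4‖ :=
        hUV (Set.mk_mem_prod hsU (Set.mem_univ x))
      rw [norm_mul]
      exact mul_le_mul h2 (w.norm_coe_le_norm x) (norm_nonneg _) ((norm_nonneg _).trans h2)
    refine (intervalIntegral.norm_integral_le_of_norm_le_const hb).trans (le_of_eq ?_)
    rw [sub_zero, abs_of_pos hL]
    ring
  obtain ⟨-, h1, h2, h3⟩ := cubic_eq_zero_of_isBigO key
  exact ⟨h1, h2, h3⟩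

end HasExpansion

/-! ### Taylor expansions of analytic functions -/

theorem _root_.HasFPowerSeriesAt.sub_cubic_isBigO {E : Type*} [NormedAddCommGroup E]
    [NormedSpace ℝ E] {f : ℝ → E} {q : FormalMultilinearSeries ℝ ℝ E} {x : ℝ}
    (h : HasFPowerSeriesAt f q x) :
    (fun y : ℝ => f (x + y) - (q.coeff 0 + y • q.coeff 1 + y ^ 2 • q.coeff 2 + y ^ 3 • q.coeff 3))
      =O[𝓝 0] fun y => y ^ 4 := by
  refine ((h.isBigO_sub_partialSum_pow 4).trans (IsBigO.of_norm_right ?_)).congr_left fun y => ?_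
  · simpa using isBigO_refl _ _
  · simp [FormalMultilinearSeries.partialSum, Finset.sum_range_succ]

theorem _root_.AnalyticAt.hasCubicTaylor {f : ℝ → ℝ} {x : ℝ} (h : AnalyticAt ℝ f x) :
    HasCubicTaylor (fun y => f (x + y)) (f x) (deriv f x) (iteratedDeriv 2 f x / 2)
      (iteratedDeriv 3 f x / 6) := by
  refine h.hasFPowerSeriesAt.sub_cubic_isBigO.congr_left fun y => ?_
  simp [FormalMultilinearSeries.coeff_ofScalars, Nat.factorial]

theorem hasCubicTaylor_exp : HasCubicTaylor Real.exp 1 1 (1 / 2) (1 / 6) := by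
  have h := (analyticAt_rexp (x := 0)).hasCubicTaylor
  simpa [iteratedDeriv_eq_iterate] using h

theorem hasCubicTaylor_inv_sq : HasCubicTaylor (fun y => 1 / (1 + y) ^ 2) 1 (-2) 3 (-4) := by
  -- The exact remainder is `y⁴ (5 + 4y) / (1 + y)²`.
  have hc : ContinuousAt (fun y : ℝ => (5 + 4 * y) / (1 + y) ^ 2) 0 := by
    apply ContinuousAt.div <;> first | fun_prop | norm_num
  have h := (isBigO_refl (fun y : ℝ => y ^ 4) (𝓝 0)).mul (hc.isBigO_one ℝ)
  simp only [mul_one] at h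
  refine h.congr' ?_ EventuallyEq.rfl
  have : ∀ᶠ y : ℝ in 𝓝 0, 1 + y ≠ 0 :=
    ContinuousAt.eventually_ne (by fun_prop) (by norm_num)
  filter_upwards [this] with y hy
  field_simp
  ring

/-! ### Integrals over a period and Green's identity -/

/-- Integration over a period as a linear functional. -/
def periodIntegral (L : ℝ) : (ℝ →ᵇ ℝ) →ₗ[ℝ] ℝ where
  toFun f := ∫ x in 0..L, f x
  map_add' f g := intervalIntegral.integral_add (f.continuous.intervalIntegrable _ _)
    (g.continuous.intervalIntegrable _ _)
  map_smul' r f := by simp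

theorem periodIntegral_cosX_pow {L : ℝ} (hL : 0 < L) (n : ℕ) :
    periodIntegral L ((cosX L : ℝ →ᵇ ℝ) ^ n) =
      L / (2 * Real.pi) * ∫ x in 0..2 * Real.pi, Real.cos x ^ n := by
  have hk : 2 * Real.pi / L ≠ 0 := by positivity
  have h := intervalIntegral.integral_comp_mul_left (a := 0) (b := L)
    (fun x => Real.cos x ^ n) hk
  have hL' : 2 * Real.pi / L * L = 2 * Real.pi := by field_simp
  rw [mul_zero, hL', inv_div] at h
  exact h

theorem periodIntegral_one {L : ℝ} : periodIntegral L 1 = L := by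
  simp [periodIntegral]

theorem periodIntegral_cosX {L : ℝ} (hL : 0 < L) :
    periodIntegral L (cosX L : ℝ →ᵇ ℝ) = 0 := by
  have h := periodIntegral_cosX_pow hL 1
  simpa using h

theorem periodIntegral_cosX_sq {L : ℝ} (hL : 0 < L) :
    periodIntegral L ((cosX L : ℝ →ᵇ ℝ) ^ 2) = L / 2 := by
  rw [periodIntegral_cosX_pow hL, integral_cos_sq]
  simp
  field_simp

theorem periodIntegral_cosX_cube {L : ℝ} (hL : 0 < L) :
    periodIntegral L ((cosX L : ℝ →ᵇ ℝ) ^ 3) = 0 := by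
  rw [periodIntegral_cosX_pow hL, integral_cos_pow (n := 1)]
  simp

theorem periodIntegral_cosX_pow_four {L : ℝ} (hL : 0 < L) :
    periodIntegral L ((cosX L : ℝ →ᵇ ℝ) ^ 4) = 3 * L / 8 := by
  rw [periodIntegral_cosX_pow hL, integral_cos_pow (n := 2), integral_cos_sq]
  simp
  field_simp
  norm_num

/-- Green's identity over a period. -/
theorem IsEllipticSolution.integral_mul_eq_zero {L μ : ℝ} {f φ g g' : ℝ → ℝ}
    (h : IsEllipticSolution L f φ) (hg : ∀ x, HasDerivAt g (g' x) x)
    (hg' : ∀ x, HasDerivAt g' (-(μ * g x)) x) (pg : g.Periodic L) (pg' : g'.Periodic L) :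
    ∫ x in 0..L, (μ * φ x + Real.exp (φ x) + (-1) * f x) * g x = 0 := by
  obtain ⟨hφ, hper, hsol⟩ := h
  have h1 : ContDiff ℝ 1 (deriv φ) := ((contDiff_succ_iff_deriv (n := 1)).1 hφ).2.2
  have hd : ∀ x, HasDerivAt φ (deriv φ x) x := fun x =>
    ((hφ.differentiable (by norm_num)) x).hasDerivAt
  have hd' : ∀ x, HasDerivAt (deriv φ) (deriv (deriv φ) x) x := fun x =>
    ((h1.differentiable (by norm_num)) x).hasDerivAt
  have hperd : Function.Periodic (deriv φ) L := fun x => by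
    rw [← deriv_comp_add_const]
    congr 1
    exact funext hper
  have hgc : Continuous g := continuous_iff_continuousAt.2 fun x => (hg x).continuousAt
  have hcd : Continuous (deriv (deriv φ)) := h1.continuous_deriv le_rfl
  -- The primitive `φ'g - φg'` takes equal values at `0` and `L` by periodicity.
  have hderiv : ∀ x ∈ Set.uIcc 0 L, HasDerivAt (fun y => deriv φ y * g y - φ y * g' y)
      ((deriv (deriv φ) x + μ * φ x) * g x) x := fun x _ => by
    refine (((hd' x).mul (hg x)).sub ((hd x).mul (hg' x))).congr_deriv ?_
    ring
  have hint := intervalIntegral.integral_eq_sub_of_hasDerivAt hderiv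
    (((hcd.add (continuous_const.mul hφ.continuous)).mul hgc).intervalIntegrable _ _)
  have h0 : deriv φ L = deriv φ 0 ∧ φ L = φ 0 ∧ g L = g 0 ∧ g' L = g' 0 := by
    refine ⟨?_, ?_, ?_, ?_⟩
    · simpa using hperd 0
    · simpa using hper 0
    · simpa using pg 0
    · simpa using pg' 0
  rw [h0.1, h0.2.1, h0.2.2.1, h0.2.2.2, sub_self] at hint
  rw [← hint]
  congr 1
  funext x
  rw [← hsol x, ellipticH]
  ring

/-! ### Expansions along a local branch -/

section Branch

variable {p : ℝ → ℝ} {L ε : ℝ} {Ψ : ℝ → ℝ} {Φ : ℝ → evenPeriodic L}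

namespace IsLocalBranch

/-- Analyticity into the sup-norm space makes the Taylor remainder uniform in `x`; comparison with
the prescribed `O(s²)` expansion identifies the linear coefficient. -/
theorem exists_expansion (h : IsLocalBranch p L ε Ψ Φ) : ∃ a b : ℝ →ᵇ ℝ,
    HasExpansion (fun s x => (Φ s : ℝ →ᵇ ℝ) x) 1 (cosX L : ℝ →ᵇ ℝ) a b := by
  obtain ⟨q, hq⟩ := h.analytic_profile 0 ⟨neg_lt_zero.2 h.eps_pos, h.eps_pos⟩
  have hT := hq.sub_cubic_isBigO
  simp only [zero_add] at hT
  have h0 : q.coeff 0 = oneX L := by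
    rw [← h.profile_zero, ← hq.coeff_zero (fun _ => 1)]
    rfl
  have h1 : q.coeff 1 = cosX L := by
    rw [← sub_eq_zero]
    refine eq_zero_of_pow_smul_isBigO (E := evenPeriodic L) (n := 1) ?_
    refine IsBigO.mono (l' := 𝓝 0) ?_ nhdsWithin_le_nhds
    have k2 := isBigO_pow_smul 2 (q.coeff 2)
    have k3 := (isBigO_pow_smul 3 (q.coeff 3)).trans
      (isBigO_pow_pow_of_le (show 2 ≤ 3 by norm_num))
    have := ((h.expansion.sub (hT.trans (isBigO_pow_pow_of_le (show 2 ≤ 4 by norm_num)))).sub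
      k2).sub k3
    refine this.congr_left fun s => ?_
    rw [h0, smul_sub, pow_one]
    abel
  refine ⟨q.coeff 2, q.coeff 3, ?_⟩
  rw [h0, h1] at hT
  have hT' := hT.comp_tendsto tendsto_fst_nhds_zero
  refine (IsBigO.of_bound 1 (Eventually.of_forall fun z => ?_)).trans hT'
  rw [one_mul]
  refine le_trans (le_of_eq ?_) (BoundedContinuousFunction.norm_coe_le_norm _ z.2)
  congr 1

/-- The expansion of `-𝓖(Ψ, Φ)` along a branch. -/
theorem expansion_localG (h : IsLocalBranch p L ε Ψ Φ) (hp : AnalyticAt ℝ p 1)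
    {a b : ℝ →ᵇ ℝ} (hΦ : HasExpansion (fun s x => (Φ s : ℝ →ᵇ ℝ) x) 1 (cosX L : ℝ →ᵇ ℝ) a b)
    {C₀ C₁ C₂ D m n : ℝ} (hC₀ : C₀ = Ψ 0 ^ 2) (hC₁ : C₁ = 2 * Ψ 0 * deriv Ψ 0)
    (hC₂ : C₂ = Ψ 0 * iteratedDeriv 2 Ψ 0 + deriv Ψ 0 ^ 2) (hD : D = C₀ - deriv p 1)
    (hm : m = (3 * C₀ + iteratedDeriv 2 p 1) / 2) (hn : n = 2 * C₀ - iteratedDeriv 3 p 1 / 6) :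
    HasExpansion (fun s x => -localG p (Ψ s) ((Φ s : ℝ →ᵇ ℝ) x)) 0 (D • (cosX L : ℝ →ᵇ ℝ))
      (D • a + C₁ • (cosX L : ℝ →ᵇ ℝ) - m • (cosX L : ℝ →ᵇ ℝ) ^ 2)
      (D • b + C₁ • a + C₂ • (cosX L : ℝ →ᵇ ℝ) - (2 * m) • ((cosX L : ℝ →ᵇ ℝ) * a)
        - (3 / 2 * C₁) • (cosX L : ℝ →ᵇ ℝ) ^ 2 + n • (cosX L : ℝ →ᵇ ℝ) ^ 3) := by
  have he : HasExpansion (fun s x => (Φ s : ℝ →ᵇ ℝ) x + (-1)) 0 (cosX L : ℝ →ᵇ ℝ) a b := by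
    refine (hΦ.add (HasExpansion.const (-1))).congr_coeff ?_ ?_ ?_ ?_ <;> ext x <;> simp
  have hΨ := (h.analytic_speed 0 ⟨neg_lt_zero.2 h.eps_pos, h.eps_pos⟩).hasCubicTaylor
  simp only [zero_add] at hΨ
  have hΨ' := HasExpansion.of_cubicTaylor hΨ
  have hinv := (he.comp_cubicTaylor hasCubicTaylor_inv_sq).add (HasExpansion.const (-1))
  have hpr := (he.comp_cubicTaylor hp.hasCubicTaylor).add (HasExpansion.const (-p 1))
  -- With `η = Φ - 1` and `Ψ² = C₀ + C₁s + C₂s² + …`, freezing `Ψ² = C₀` gives `-𝓖 = Dη - mη² + nη³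
  -- + …`; the terms in `C₁` and `C₂` correct for the variation of the speed.
  have hall := (((hΨ'.mul hΨ').mul hinv).const_mul (-1 / 2)).add (hpr.const_mul (-1))
  have hfun : (fun s x => -localG p (Ψ s) ((Φ s : ℝ →ᵇ ℝ) x)) = fun s x =>
      -1 / 2 * (Ψ s * Ψ s * (1 / (1 + ((Φ s : ℝ →ᵇ ℝ) x + -1)) ^ 2 + -1)) +
      -1 * (p (1 + ((Φ s : ℝ →ᵇ ℝ) x + -1)) + -p 1) := by
    funext s x
    have : 1 + ((Φ s : ℝ →ᵇ ℝ) x + -1) = (Φ s : ℝ →ᵇ ℝ) x := by ring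
    rw [this, localG]
    ring
  rw [hfun]
  subst hC₁ hC₂ hD hm hn hC₀
  refine hall.congr_coeff ?_ ?_ ?_ ?_ <;>
  · ext x
    simp
    try ring

/-- Near the bifurcation point, `-𝓖(Ψ, Φ)` solves the elliptic equation. -/
theorem eventually_isEllipticSolution (h : IsLocalBranch p L ε Ψ Φ) {b c d : ℝ →ᵇ ℝ}
    (hG : HasExpansion (fun s x => -localG p (Ψ s) ((Φ s : ℝ →ᵇ ℝ) x)) 0 b c d)
    (hb : b 0 ≠ 0) :
    ∀ᶠ s in 𝓝[≠] 0, IsEllipticSolution L (Φ s : ℝ →ᵇ ℝ)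
      (fun x => -localG p (Ψ s) ((Φ s : ℝ →ᵇ ℝ) x)) := by
  -- At `x = 0` the quotient by `s` tends to `b 0 ≠ 0`. This will exclude the default value `0` of
  -- `ellipticHInv`.
  have hnz : ∀ᶠ s in 𝓝[≠] (0 : ℝ), -localG p (Ψ s) ((Φ s : ℝ →ᵇ ℝ) 0) ≠ 0 := by
    have ht : Tendsto (fun s : ℝ => (s, (0 : ℝ))) (𝓝[≠] 0) (𝓝 0 ×ˢ ⊤) :=
      (tendsto_id.mono_right nhdsWithin_le_nhds).prodMk tendsto_top
    have h1 := (hG.comp_tendsto ht).mul (isBigO_refl (fun s : ℝ => s⁻¹) (𝓝[≠] 0))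
    have h2 : Tendsto (fun s : ℝ => s ^ 3) (𝓝[≠] 0) (𝓝 0) := by
      simpa using ((continuous_pow 3).tendsto (0 : ℝ)).mono_left nhdsWithin_le_nhds
    have h3 : Tendsto (fun s : ℝ => b 0 + s * c 0 + s ^ 2 * d 0) (𝓝[≠] 0) (𝓝 (b 0)) := by
      have : Continuous fun s : ℝ => b 0 + s * c 0 + s ^ 2 * d 0 := by fun_prop
      simpa using (this.tendsto 0).mono_left nhdsWithin_le_nhds
    have h4 := (h1.trans_tendsto (h2.congr' (by
      filter_upwards [self_mem_nhdsWithin] with s hs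
      have : s ≠ 0 := hs
      simp only [Function.comp_apply]
      field_simp))).add h3
    rw [zero_add] at h4
    filter_upwards [h4.eventually_ne hb, self_mem_nhdsWithin] with s hs hs0 h0
    have hs0 : s ≠ 0 := hs0
    apply hs
    simp only [Function.comp_apply, h0]
    simp
    field_simp
    ring
  filter_upwards [hnz, nhdsWithin_le_nhds (Ioo_mem_nhds (neg_lt_zero.2 h.eps_pos) h.eps_pos)]
    with s hs hsI
  have hsol : ellipticHInv L (Φ s : ℝ →ᵇ ℝ) = fun x => -localG p (Ψ s) ((Φ s : ℝ →ᵇ ℝ) x) :=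
    funext fun x => by linarith [h.solves s hsI x, (show waveF L p (Ψ s) (Φ s : ℝ →ᵇ ℝ) x =
      localG p (Ψ s) ((Φ s : ℝ →ᵇ ℝ) x) + ellipticHInv L (Φ s : ℝ →ᵇ ℝ) x from rfl)]
  -- If a solution exists, the chosen one equals `-𝓖`, whichever it is, so uniqueness is not needed.
  -- If none exists, `ellipticHInv` is `0`, against `hnz`.
  by_cases hex : ∃ φ : ℝ → ℝ, IsEllipticSolution L (Φ s : ℝ →ᵇ ℝ) φ
  · have := hex.choose_spec
    rw [← hsol, ellipticHInv, dif_pos hex]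
    exact this
  · rw [ellipticHInv, dif_neg hex] at hsol
    exact absurd (congrFun hsol 0).symm hs

end IsLocalBranch

/-- The solvability conditions at second and third order obtained by projecting the elliptic
equation on an eigenfunction `w` of `-d²/dx²` with eigenvalue `μ`. -/
theorem periodIntegral_coeff_eq_zero (hL : 0 < L) {a b f₁ f₂ f₃ : ℝ →ᵇ ℝ}
    (hΦ : HasExpansion (fun s x => (Φ s : ℝ →ᵇ ℝ) x) 1 (cosX L : ℝ →ᵇ ℝ) a b)
    (hG : HasExpansion (fun s x => -localG p (Ψ s) ((Φ s : ℝ →ᵇ ℝ) x)) 0 f₁ f₂ f₃)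
    (hsol : ∀ᶠ s in 𝓝[≠] 0, IsEllipticSolution L (Φ s : ℝ →ᵇ ℝ)
      (fun x => -localG p (Ψ s) ((Φ s : ℝ →ᵇ ℝ) x)))
    {μ : ℝ} {w w' : ℝ →ᵇ ℝ} (hw : ∀ x, HasDerivAt w (w' x) x)
    (hw' : ∀ x, HasDerivAt w' (-(μ * w x)) x) (pw : Function.Periodic w L)
    (pw' : Function.Periodic w' L) :
    periodIntegral L (((1 + μ) • f₂ + (1 / 2 : ℝ) • f₁ ^ 2 - a) * w) = 0 ∧
    periodIntegral L (((1 + μ) • f₃ + f₁ * f₂ + (1 / 6 : ℝ) • f₁ ^ 3 - b) * w) = 0 := by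
  have hr := ((hG.const_mul μ).add (hG.comp_cubicTaylor hasCubicTaylor_exp)).add
    (hΦ.const_mul (-1))
  obtain ⟨-, h2, h3⟩ := hr.integral_eq_zero (w := w) hL
    (hsol.mono fun s hs => by
      have h1 := hs.1.continuous
      have h2 := (Φ s : ℝ →ᵇ ℝ).continuous
      fun_prop)
    (hsol.mono fun s hs => hs.integral_mul_eq_zero hw hw' pw pw')
  constructor
  · refine Eq.trans ?_ h2
    change periodIntegral L _ = periodIntegral L _
    congr 1
    ext x
    simp only [BoundedContinuousFunction.coe_mul, BoundedContinuousFunction.coe_add,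
      BoundedContinuousFunction.coe_sub, BoundedContinuousFunction.coe_smul,
      BoundedContinuousFunction.coe_pow, Pi.mul_apply, Pi.add_apply, Pi.sub_apply, Pi.pow_apply,
      smul_eq_mul]
    ring
  · refine Eq.trans ?_ h3
    change periodIntegral L _ = periodIntegral L _
    congr 1
    ext x
    simp only [BoundedContinuousFunction.coe_mul, BoundedContinuousFunction.coe_add,
      BoundedContinuousFunction.coe_sub, BoundedContinuousFunction.coe_smul,
      BoundedContinuousFunction.coe_pow, Pi.mul_apply, Pi.add_apply, Pi.sub_apply, Pi.pow_apply,
      smul_eq_mul]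
    ring

end Branch
-- Trigonometric test functions and the period polynomial
/-- The function `x ↦ sin (2π x / L)`. -/
def sinB (L : ℝ) : ℝ →ᵇ ℝ :=
  BoundedContinuousFunction.ofNormedAddCommGroup (fun x : ℝ => Real.sin (2 * Real.pi / L * x))
    (by fun_prop) 1 (fun x => by simpa using Real.abs_sin_le_one _)

theorem sinB_periodic {L : ℝ} (hL : 0 < L) : Function.Periodic (sinB L) L := fun x => by
  have h : 2 * Real.pi / L * (x + L) = 2 * Real.pi / L * x + 2 * Real.pi := by
    field_simp
  simp [sinB, h]

theorem cosX_periodic (L : ℝ) : Function.Periodic (cosX L : ℝ →ᵇ ℝ) L := (cosX L).2.2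

theorem hasDerivAt_cosX (L x : ℝ) :
    HasDerivAt (cosX L : ℝ →ᵇ ℝ) (-(2 * Real.pi / L * sinB L x)) x := by
  have h := ((hasDerivAt_id x).const_mul (2 * Real.pi / L)).cos
  refine h.congr_deriv ?_
  simp [sinB]
  ring

theorem hasDerivAt_sinB (L x : ℝ) :
    HasDerivAt (sinB L) (2 * Real.pi / L * (cosX L : ℝ →ᵇ ℝ) x) x := by
  have h := ((hasDerivAt_id x).const_mul (2 * Real.pi / L)).sin
  refine h.congr_deriv ?_
  simp [cosX]
  ring

theorem cosX_sq_add_sinB_sq (L x : ℝ) : (cosX L : ℝ →ᵇ ℝ) x ^ 2 + sinB L x ^ 2 = 1 :=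
  Real.cos_sq_add_sin_sq _

theorem eval_periodPoly (p₁ p₂ p₃ t : ℝ) : (periodPoly p₁ p₂ p₃).eval t =
    6 * ((3 * p₁ + p₂) * (1 + t) ^ 2 + 3 * t + 2) ^ 2 * (1 + t) * (1 + 4 * t)
    - ((3 * p₁ + p₂) * (1 + t) ^ 2 * (1 + 4 * t) + 12 * t ^ 2 + 15 * t + 2) ^ 2 * (1 + t)
    + 3 * t * (1 + t) ^ 3 * (1 + 4 * t) * ((12 * p₁ - p₃) * (1 + t) + 12)
    - 6 * t * (1 + 2 * t) := by
  simp [periodPoly]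

/-- At `t = -1` every summand with the factor `1 + t` vanishes, and the last one equals `-6`
whatever the pressure. -/
theorem periodPoly_ne_zero (p₁ p₂ p₃ : ℝ) : periodPoly p₁ p₂ p₃ ≠ 0 := fun h => by
  have := eval_periodPoly p₁ p₂ p₃ (-1)
  rw [h] at this
  norm_num at this

theorem natDegree_periodPoly_le (p₁ p₂ p₃ : ℝ) : (periodPoly p₁ p₂ p₃).natDegree ≤ 8 := by
  unfold periodPoly
  compute_degree
  norm_num

/-- Elimination of the second order coefficients from the projected equations. -/
theorem eval_periodPoly_of_projections {t L p₁ p₂ p₃ C₀ C₂ D m n A₀ A₂ : ℝ} (ht : 0 < t)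
    (hL : L ≠ 0) (hD : D = 1 / (1 + t)) (hC₀ : C₀ = p₁ + D) (hm : m = (3 * C₀ + p₂) / 2)
    (hn : n = 2 * C₀ - p₃ / 6) (h₀ : (D - 1) * A₀ + (D ^ 2 / 2 - m) * (L / 2) = 0)
    (h₂ : ((1 + 4 * t) * D - 1) * (2 * A₂ - A₀) + (D ^ 2 / 2 - (1 + 4 * t) * m) * (L / 4) = 0)
    (h₁ : (1 + t) * (C₂ * (L / 2) - 2 * m * A₂ + n * (3 * L / 8))
      + D * (D * A₂ - m * (3 * L / 8)) + D ^ 3 / 6 * (3 * L / 8) = 0) :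
    (periodPoly p₁ p₂ p₃).eval t = -24 * t * (1 + t) ^ 4 * (1 + 4 * t) * C₂ := by
  have hu : 1 + t ≠ 0 := by positivity
  -- Since `t ≠ 0`, the modes `0` and `2` are not resonant: both factors below are nonzero, so `h₀`
  -- and `h₂` can be solved for `A₀ = ∫ a` and `A₂ = ∫ aK²`.
  have ht0 : t ≠ 0 := ht.ne'
  have eD : D - 1 = -t / (1 + t) := by rw [hD]; field_simp; ring
  have eD' : (1 + 4 * t) * D - 1 = 3 * t / (1 + t) := by rw [hD]; field_simp; ring
  have hA₀ : A₀ = (D ^ 2 / 2 - m) * (L / 2) * (1 + t) / t := by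
    rw [eD] at h₀
    field_simp at h₀ ⊢
    linear_combination -h₀
  have hA₂ : A₂ = (A₀ - (D ^ 2 / 2 - (1 + 4 * t) * m) * (L / 4) * (1 + t) / (3 * t)) / 2 := by
    rw [eD'] at h₂
    field_simp at h₂ ⊢
    linear_combination h₂
  have hC₂ : C₂ = -2 / L * (n * (3 * L / 8) - 2 * m * A₂
      + (D * (D * A₂ - m * (3 * L / 8)) + D ^ 3 / 6 * (3 * L / 8)) / (1 + t)) := by
    field_simp at h₁ ⊢
    linear_combination h₁
  rw [eval_periodPoly, hC₂, hA₂, hA₀, hn, hm, hC₀, hD]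
  field_simp
  ring

/-! ### Derivatives of the speed at the bifurcation point -/

section Branch

variable {p : ℝ → ℝ} {L ε : ℝ} {Ψ : ℝ → ℝ} {Φ : ℝ → evenPeriodic L}

/-- Along a local branch the speed is stationary at the bifurcation point, and its second
derivative is an explicit multiple of the value of the polynomial of the pressure. -/
theorem IsLocalBranch.deriv_speed (h : IsLocalBranch p L ε Ψ Φ) (hp : AnalyticAt ℝ p 1)
    (hp₁ : 0 < deriv p 1) (hL : 0 < L) {t : ℝ} (ht : t = (2 * Real.pi / L) ^ 2) :
    deriv Ψ 0 = 0 ∧ (pressurePoly p).eval t =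
      -24 * t * (1 + t) ^ 4 * (1 + 4 * t) * (Ψ 0 * iteratedDeriv 2 Ψ 0) := by
  have htpos : 0 < t := by rw [ht]; positivity
  obtain ⟨D, hD⟩ : ∃ D, D = 1 / (1 + t) := ⟨_, rfl⟩
  have hDpos : 0 < D := by rw [hD]; positivity
  have hDt : (1 + t) * D = 1 := by rw [hD]; field_simp
  have hΨ0 : Ψ 0 = Real.sqrt (deriv p 1 + D) := by
    rw [h.speed_zero, hD, ht, bifurcationSpeed]
  have hΨpos : 0 < Ψ 0 := by rw [hΨ0]; positivity
  have hC : Ψ 0 ^ 2 = deriv p 1 + D := by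
    rw [hΨ0, Real.sq_sqrt (by positivity)]
  obtain ⟨a, b, hΦ⟩ := h.exists_expansion
  obtain ⟨C₁, hC₁⟩ : ∃ C₁, C₁ = 2 * Ψ 0 * deriv Ψ 0 := ⟨_, rfl⟩
  obtain ⟨C₂, hC₂⟩ : ∃ C₂, C₂ = Ψ 0 * iteratedDeriv 2 Ψ 0 + deriv Ψ 0 ^ 2 := ⟨_, rfl⟩
  obtain ⟨m, hm⟩ : ∃ m, m = (3 * Ψ 0 ^ 2 + iteratedDeriv 2 p 1) / 2 := ⟨_, rfl⟩
  obtain ⟨n, hn⟩ : ∃ n, n = 2 * Ψ 0 ^ 2 - iteratedDeriv 3 p 1 / 6 := ⟨_, rfl⟩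
  have hG := h.expansion_localG hp hΦ rfl hC₁ hC₂ (show D = Ψ 0 ^ 2 - deriv p 1 by rw [hC]; ring)
    hm hn
  have hsol := h.eventually_isEllipticSolution hG (by simp [cosX, hDpos.ne'])
  have hκ : (2 * Real.pi / L) * (2 * Real.pi / L) = t := by rw [ht, sq]
  have e0 := periodIntegral_coeff_eq_zero hL hΦ hG hsol (μ := 0) (w := 1) (w' := 0)
    (fun x => hasDerivAt_const x (1 : ℝ)) (fun x => by simp)
    (fun x => rfl) (fun x => rfl)
  have e1 := periodIntegral_coeff_eq_zero hL hΦ hG hsol (μ := t) (w := cosX L)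
    (w' := -((2 * Real.pi / L) • sinB L))
    (fun x => by simpa using hasDerivAt_cosX L x)
    (fun x => by
      refine (((hasDerivAt_sinB L x).const_mul (2 * Real.pi / L)).neg).congr_deriv ?_
      rw [← hκ]; ring)
    (cosX_periodic L) (fun x => by simp [sinB_periodic hL x])
  -- The test function is `cos(4πx/L) = 2K² - 1`, so only integrals of powers of `K`, with or
  -- without the factor `a`, occur below.
  have e2 := periodIntegral_coeff_eq_zero hL hΦ hG hsol (μ := 4 * t)
    (w := (2 : ℝ) • (cosX L : ℝ →ᵇ ℝ) ^ 2 - 1)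
    (w' := -((4 * (2 * Real.pi / L)) • (sinB L * cosX L)))
    (fun x => by
      refine ((((hasDerivAt_cosX L x).pow 2).const_mul 2).sub_const 1).congr_deriv ?_
      simp
      ring)
    (fun x => by
      refine ((((hasDerivAt_sinB L x).mul (hasDerivAt_cosX L x)).const_mul
        (4 * (2 * Real.pi / L))).neg).congr_deriv ?_
      simp
      linear_combination (-4 * (2 * Real.pi / L) ^ 2) * cosX_sq_add_sinB_sq L x
        + (4 * (2 * (cosX L : ℝ →ᵇ ℝ) x ^ 2 - 1)) * hκ)
    (fun x => by simp [cosX_periodic L x])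
    (fun x => by simp [cosX_periodic L x, sinB_periodic hL x])
  set K : ℝ →ᵇ ℝ := (cosX L : ℝ →ᵇ ℝ) with hK
  have I0 : periodIntegral L 1 = L := periodIntegral_one
  have I1 : periodIntegral L K = 0 := periodIntegral_cosX hL
  have I2 : periodIntegral L (K ^ 2) = L / 2 := periodIntegral_cosX_sq hL
  have I3 : periodIntegral L (K ^ 3) = 0 := periodIntegral_cosX_cube hL
  have I4 : periodIntegral L (K ^ 4) = 3 * L / 8 := periodIntegral_cosX_pow_four hL
  have E0 : (D - 1) * periodIntegral L a + (D ^ 2 / 2 - m) * (L / 2) = 0 := by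
    have := e0.1
    rw [show ((1 + (0 : ℝ)) • (D • a + C₁ • K - m • K ^ 2) + (1 / 2 : ℝ) • (D • K) ^ 2 - a) * 1 =
      (D - 1) • a + C₁ • K + (D ^ 2 / 2 - m) • K ^ 2 by ext x; simp; ring] at this
    simpa only [map_add, map_smul, smul_eq_mul, I1, I2, mul_zero, add_zero] using this
  -- `(1+t)D = 1` removes `a`, and `K³` has zero integral, so only the term in `C₁` survives.
  have E1 : C₁ = 0 := by
    have := e1.1
    rw [show ((1 + t) • (D • a + C₁ • K - m • K ^ 2) + (1 / 2 : ℝ) • (D • K) ^ 2 - a) * K =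
      ((1 + t) * D - 1) • (a * K) + ((1 + t) * C₁) • K ^ 2 + (D ^ 2 / 2 - (1 + t) * m) • K ^ 3 by
        ext x; simp; ring] at this
    simp only [map_add, map_smul, smul_eq_mul, I2, I3, hDt] at this
    have h' : (1 + t) * (L / 2) * C₁ = 0 := by linear_combination this
    exact (mul_eq_zero.1 h').resolve_left (by positivity)
  have E2 : ((1 + 4 * t) * D - 1) * (2 * periodIntegral L (a * K ^ 2) - periodIntegral L a)
      + (D ^ 2 / 2 - (1 + 4 * t) * m) * (L / 4) = 0 := by
    have := e2.1
    rw [show ((1 + 4 * t) • (D • a + C₁ • K - m • K ^ 2) + (1 / 2 : ℝ) • (D • K) ^ 2 - a)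
        * ((2 : ℝ) • K ^ 2 - 1) =
      ((1 + 4 * t) * D - 1) • ((2 : ℝ) • (a * K ^ 2) - a)
        + ((1 + 4 * t) * C₁) • ((2 : ℝ) • K ^ 3 - K)
        + (D ^ 2 / 2 - (1 + 4 * t) * m) • ((2 : ℝ) • K ^ 4 - K ^ 2) by
        ext x; simp; ring] at this
    simp only [map_add, map_sub, map_smul, smul_eq_mul, I1, I2, I3, I4] at this
    linear_combination this
  -- The same resonance `(1+t)D = 1` removes `b`; of the unknown profile only `∫ aK²` is left.
  have E3 : (1 + t) * (C₂ * (L / 2) - 2 * m * periodIntegral L (a * K ^ 2) + n * (3 * L / 8))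
      + D * (D * periodIntegral L (a * K ^ 2) - m * (3 * L / 8))
      + D ^ 3 / 6 * (3 * L / 8) = 0 := by
    have := e1.2
    rw [E1, show ((1 + t) • (D • b + (0 : ℝ) • a + C₂ • K - (2 * m) • (K * a)
          - (3 / 2 * (0 : ℝ)) • K ^ 2 + n • K ^ 3)
        + D • K * (D • a + (0 : ℝ) • K - m • K ^ 2) + (1 / 6 : ℝ) • (D • K) ^ 3 - b) * K =
      ((1 + t) * D - 1) • (b * K)
        + (1 + t) • (C₂ • K ^ 2 - (2 * m) • (a * K ^ 2) + n • K ^ 4)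
        + D • (D • (a * K ^ 2) - m • K ^ 4) + (D ^ 3 / 6) • K ^ 4 by
        ext x; simp; ring] at this
    simp only [map_add, map_sub, map_smul, smul_eq_mul, I2, I4, hDt] at this
    linear_combination this
  have hd : deriv Ψ 0 = 0 := by
    rw [hC₁] at E1
    exact (mul_eq_zero.1 E1).resolve_left (by positivity)
  refine ⟨hd, ?_⟩
  have hfin := eval_periodPoly_of_projections htpos hL.ne' hD hC hm hn E0 E2 E3
  rw [pressurePoly, hfin, hC₂, hd]
  ring

/-- The factors multiplying `Ψ''(0)` do not vanish: `Ψ(0) > 0` because `p'(1) > 0`, and the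
polynomial in `t` is negative for `t > 0`. -/
theorem AdmissiblePressure.iteratedDeriv_speed_eq_zero_iff (hp : AdmissiblePressure p)
    (hL : 0 < L) (h : IsLocalBranch p L ε Ψ Φ) :
    deriv Ψ 0 = 0 ∧
      (iteratedDeriv 2 Ψ 0 = 0 ↔ (pressurePoly p).eval ((2 * Real.pi / L) ^ 2) = 0) := by
  have hp₁ := hp.deriv_pos 1 one_pos
  obtain ⟨hd, hQ⟩ := h.deriv_speed (hp.analytic 1 (Set.mem_Ioi.2 one_pos)) hp₁ hL rfl
  refine ⟨hd, ?_⟩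
  have hΨ : Ψ 0 ≠ 0 := by
    rw [h.speed_zero, bifurcationSpeed]
    positivity
  have ht : 0 < (2 * Real.pi / L) ^ 2 := by positivity
  rw [hQ]
  generalize (2 * Real.pi / L) ^ 2 = t at ht
  have h1 : -24 * t * (1 + t) ^ 4 * (1 + 4 * t) ≠ 0 := by
    have : 0 < t * (1 + t) ^ 4 * (1 + 4 * t) := by positivity
    intro h0
    linarith
  constructor
  · intro h0
    rw [h0, mul_zero, mul_zero]
  · intro h0
    exact (mul_eq_zero.1 ((mul_eq_zero.1 h0).resolve_left h1)).resolve_left hΨ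

end Branch

/-! ### Counting the exceptional periods -/

/-- The periods at which a nonzero polynomial of degree at most `d` vanishes at `(2π / L)²`. -/
theorem encard_setOf_period_le {Q : Polynomial ℝ} (hQ : Q ≠ 0) {d : ℕ} (hd : Q.natDegree ≤ d) :
    {L : ℝ | 0 < L ∧ Q.eval ((2 * Real.pi / L) ^ 2) = 0}.encard ≤ d := by
  have hinj : Set.InjOn (fun L : ℝ => (2 * Real.pi / L) ^ 2)
      {L : ℝ | 0 < L ∧ Q.eval ((2 * Real.pi / L) ^ 2) = 0} := by
    rintro x ⟨hx, -⟩ y ⟨hy, -⟩ hxy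
    have h1 : 2 * Real.pi / x = 2 * Real.pi / y :=
      (sq_eq_sq₀ (by positivity) (by positivity)).1 hxy
    have := Real.pi_pos
    field_simp at h1
    linarith
  rw [← hinj.encard_image]
  have hsub : (fun L : ℝ => (2 * Real.pi / L) ^ 2) ''
      {L : ℝ | 0 < L ∧ Q.eval ((2 * Real.pi / L) ^ 2) = 0} ⊆ (Q.roots.toFinset : Set ℝ) := by
    rintro _ ⟨x, ⟨-, hx⟩, rfl⟩
    simpa [hQ] using hx
  refine (Set.encard_le_encard hsub).trans ?_
  rw [Set.encard_coe_eq_coe_finsetCard]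
  exact_mod_cast (Multiset.toFinset_card_le _).trans ((Polynomial.card_roots' Q).trans hd)

end EulerPoisson

end

theorem proposition4p3 (p : ℝ → ℝ) (hp : EulerPoisson.AdmissiblePressure p) :
    (∀ L : ℝ, 0 < L → ∀ (ε : ℝ) (Ψ : ℝ → ℝ) (Φ : ℝ → EulerPoisson.evenPeriodic L),
      EulerPoisson.IsLocalBranch p L ε Ψ Φ → deriv Ψ 0 = 0) ∧
    (EulerPoisson.pressurePoly p ≠ 0 ∧ (EulerPoisson.pressurePoly p).natDegree ≤ 8 ∧
      ∀ L : ℝ, 0 < L → ∀ (ε : ℝ) (Ψ : ℝ → ℝ) (Φ : ℝ → EulerPoisson.evenPeriodic L),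
        EulerPoisson.IsLocalBranch p L ε Ψ Φ →
          (iteratedDeriv 2 Ψ 0 = 0 ↔
            (EulerPoisson.pressurePoly p).eval ((2 * Real.pi / L) ^ 2) = 0)) ∧
    ∃ N : Set ℝ, N ⊆ Set.Ioi 0 ∧ N.encard ≤ 8 ∧
      (∀ L : ℝ, 0 < L →
        (L ∈ N ↔ (EulerPoisson.pressurePoly p).eval ((2 * Real.pi / L) ^ 2) = 0)) ∧
      ∀ L ∈ Set.Ioi (0 : ℝ) \ N,
        ∀ (ε : ℝ) (Ψ : ℝ → ℝ) (Φ : ℝ → EulerPoisson.evenPeriodic L),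
          EulerPoisson.IsLocalBranch p L ε Ψ Φ → iteratedDeriv 2 Ψ 0 ≠ 0 := by
  have hQ := EulerPoisson.periodPoly_ne_zero (deriv p 1) (iteratedDeriv 2 p 1)
    (iteratedDeriv 3 p 1)
  have hdeg := EulerPoisson.natDegree_periodPoly_le (deriv p 1) (iteratedDeriv 2 p 1)
    (iteratedDeriv 3 p 1)
  refine ⟨fun L hL ε Ψ Φ h => (hp.iteratedDeriv_speed_eq_zero_iff hL h).1,
    ⟨hQ, hdeg, fun L hL ε Ψ Φ h => (hp.iteratedDeriv_speed_eq_zero_iff hL h).2⟩,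
    {L | 0 < L ∧ (EulerPoisson.pressurePoly p).eval ((2 * Real.pi / L) ^ 2) = 0},
    fun L hL => hL.1, EulerPoisson.encard_setOf_period_le hQ hdeg, fun L hL => ?_, ?_⟩
  · exact ⟨fun h => h.2, fun h => ⟨hL, h⟩⟩
  · rintro L ⟨hL, hLN⟩ ε Ψ Φ h h0
    exact hLN ⟨hL, (hp.iteratedDeriv_speed_eq_zero_iff hL h).2.1 h0⟩
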